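/- All vocabularies are finite and relational, and all structures are finite and nonempty. Let $\mathcal{L}^k$ be the infinitary logic with $k$ variables (first-order atoms, negation, arbitrary conjunctions and disjunctions, quantifiers $\exists,\forall$, using only the variables $x_1,\dots,x_k$). For a class $\mathcal{K}$ of structures over a vocabulary $\tau=\{R_1,\dots,R_m\}$ that is closed under isomorphism, the generalized quantifier $Q_{\mathcal{K}}$ binds tuples $\bar y_1,\dots,\bar y_m$ of distinct variables, with $|\bar y_i|$ the arity of $R_i$, in formulas $\psi_1,\dots,\psi_m$; the formula $Q_{\mathcal K}\bar y_1,\dots,\bar y_m(\psi_1,\dots,\psi_m)$ holds in $\mathbf{A}$ under an assignment $\alpha$ if the $\tau$-structure with universe $A$ and relations $\{\bar b\mid (\mathbf{A},\alpha[\bar b/\bar y_i])\models\psi_i\}$ lies in $\mathcal{K}$. The arity of $Q_{\mathcal K}$ is the maximum arity of the symbols in $\tau$. For a collection $\mathcal{Q}$ of quantifiers let $\mathcal{L}(\mathcal{Q})=\bigcup_{k}\mathcal{L}^k(\mathcal{Q})$, where $\mathcal{L}^k(\mathcal{Q})$ extends $\mathcal{L}^k$ by the quantifiers in $\mathcal{Q}$.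 Write $\mathcal{L}(\mathcal{Q})\le\mathcal{L}(\mathcal{Q}')$ if over every vocabulary every sentence of $\mathcal{L}(\mathcal{Q})$ is equivalent to a sentence of $\mathcal{L}(\mathcal{Q}')$, and $\mathcal{L}(\mathcal{Q})\lneq\mathcal{L}(\mathcal{Q}')$ if $\mathcal{L}(\mathcal{Q})\le\mathcal{L}(\mathcal{Q}')$ but $\mathcal{L}(\mathcal{Q}')\not\le\mathcal{L}(\mathcal{Q})$. For $\ell\ge 3$, the $\ell$-ary partial near-unanimity function $n^\ell$ on a set $A$ has the value $n^\ell(a_1,\dots,a_\ell)=a$ if at least $\ell-1$ of the $a_i$ are equal to $a$, and is undefined otherwise. For a structure $\mathbf{B}$, let $n^\ell(\mathbf{B})$ be the structure on the same universe whose relations consist of all tuples obtained by applying $n^\ell$ componentwise to $\ell$ tuples of the corresponding relation of $\mathbf{B}$. The quantifier $Q_{\mathcal{K}}$ is $\mathcal{N}^\ell$-closed if for every $\mathbf{B}\in\mathcal{K}$, every structure $\mathbf{A}$ on the same universe whose relations satisfy $R^{\mathbf{A}}\subseteq R^{\mathbf{B}}\cup R^{n^\ell(\mathbf{B})}$ is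 also in $\mathcal{K}$. It is a CSP quantifier if, for some structure $\mathbf{B}$, $\mathcal{K}$ is the class of all $\mathbf{A}$ that admit a homomorphism to $\mathbf{B}$. Let $\mathcal{Q}_r$ be the collection of all quantifiers of arity at most $r$, and $\mathcal{Q}_r^{\mathcal{N}^\ell_{\mathrm{CSP}}}$ the collection of all $\mathcal{N}^\ell$-closed CSP quantifiers of arity at most $r$. Theorem. Let $r\ge\ell\ge 3$. Then $$\mathcal{L}\bigl(\mathcal{Q}^{\mathcal{N}^\ell_{\mathrm{CSP}}}_{q(r,\ell)}\bigr)\not\le\mathcal{L}(\mathcal{Q}_r),\qquad\text{where } q(r,\ell)=(2r+1)\Bigl(\Bigl\lfloor\frac{2r+1}{\ell-1}\Bigr\rfloor+2\Bigr).$$ In particular, there is an $r'>r$ such that $\mathcal{L}\bigl(\mathcal{Q}^{\mathcal{N}^\ell_{\mathrm{CSP}}}_{r}\bigr)\lneq\mathcal{L}\bigl(\mathcal{Q}^{\mathcal{N}^\ell_{\mathrm{CSP}}}_{r'}\bigr)$. -/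

import Mathlib

namespace PolyQuant

open scoped FirstOrder

/-- A finite nonempty structure over the language `L`. -/
structure FinStr (L : FirstOrder.Language.{0, 0}) where
  carrier : Type
  str : L.Structure carrier
  finite : Finite carrier
  nonempty : Nonempty carrier

attribute [instance] FinStr.str FinStr.finite FinStr.nonempty

/-- A generalized (Lindström) quantifier: a finite relational vocabulary together with an
isomorphism-closed class of finite structures over it. -/
structure Quantifier where
  voc : FirstOrder.Language.{0, 0}
  relational : voc.IsRelational
  finite_voc : Finite (Σ n, voc.Relations n)
  cls : Set (FinStr voc)
  iso_closed : ∀ A B : FinStr voc, A ∈ cls → Nonempty (A.carrier ≃[voc] B.carrier) → B ∈ cls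

attribute [instance] Quantifier.relational Quantifier.finite_voc

/-- The formulas of `𝓛^k(𝒬)` over the vocabulary `σ`: infinitary formulas with the variables
`x_0, …, x_{k-1}` and with the generalized quantifiers in `𝒬`. Disjunctions and universal
quantifiers are expressed by negation. In `Q_K ȳ_1, …, ȳ_m (ψ_1, …, ψ_m)` there are, for every
relation symbol `R` of the vocabulary of `K`, a tuple `y R` of distinct variables, of length the
arity of `R`, and a formula `ψ R`. -/
inductive Formula (σ : FirstOrder.Language.{0, 0}) (𝒬 : Set Quantifier) (k : ℕ) : Type 1
  | eq (x y : Fin k) : Formula σ 𝒬 k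
  | rel {n : ℕ} (R : σ.Relations n) (x : Fin n → Fin k) : Formula σ 𝒬 k
  | neg (φ : Formula σ 𝒬 k) : Formula σ 𝒬 k
  | conj {ι : Type} (φ : ι → Formula σ 𝒬 k) : Formula σ 𝒬 k
  | ex (x : Fin k) (φ : Formula σ 𝒬 k) : Formula σ 𝒬 k
  | quant (Q : Quantifier) (hQ : Q ∈ 𝒬) (y : ∀ {n : ℕ}, Q.voc.Relations n → (Fin n ↪ Fin k))
      (ψ : ∀ {n : ℕ}, Q.voc.Relations n → Formula σ 𝒬 k) : Formula σ 𝒬 k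

/-- The set of free variables of a formula. -/
def Formula.freeVars {σ : FirstOrder.Language.{0, 0}} {𝒬 : Set Quantifier} {k : ℕ} :
    Formula σ 𝒬 k → Set (Fin k)
  | .eq x y => {x, y}
  | .rel _ x => Set.range x
  | .neg φ => φ.freeVars
  | .conj φ => ⋃ i, (φ i).freeVars
  | .ex x φ => φ.freeVars \ {x}
  | .quant Q _ y ψ => ⋃ (n : ℕ) (R : Q.voc.Relations n), (ψ R).freeVars \ Set.range (y R)

/-- The structure over a relational vocabulary with the given relations. -/
@[reducible]
def relStructure (L : FirstOrder.Language.{0, 0}) [L.IsRelational] (A : Type)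
    (rel : ∀ {n : ℕ}, L.Relations n → (Fin n → A) → Prop) : L.Structure A where
  funMap f := isEmptyElim f
  RelMap := rel

/-- Satisfaction `(A, α) ⊨ φ`. Here `Function.extend (y R) b α` is the assignment `α[b/y_R]`. -/
def Formula.Holds {σ : FirstOrder.Language.{0, 0}} {𝒬 : Set Quantifier} {k : ℕ} (A : FinStr σ) :
    Formula σ 𝒬 k → (Fin k → A.carrier) → Prop
  | .eq x y, α => α x = α y
  | .rel R x, α => FirstOrder.Language.Structure.RelMap R (fun i => α (x i))
  | .neg φ, α => ¬ φ.Holds A α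
  | .conj φ, α => ∀ i, (φ i).Holds A α
  | .ex x φ, α => ∃ a : A.carrier, φ.Holds A (Function.update α x a)
  | .quant Q _ y ψ, α =>
      (⟨A.carrier,
        relStructure Q.voc A.carrier (fun R b => (ψ R).Holds A (Function.extend (y R) b α)),
        A.finite, A.nonempty⟩ : FinStr Q.voc) ∈ Q.cls

/-- A sentence of `𝓛(𝒬) = ⋃ₖ 𝓛^k(𝒬)` over the vocabulary `σ`. -/
structure Sentence (σ : FirstOrder.Language.{0, 0}) (𝒬 : Set Quantifier) where
  numVars : ℕ
  formula : Formula σ 𝒬 numVars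
  closed : formula.freeVars = ∅

/-- `A ⊨ φ` for a sentence `φ` (the choice of the assignment is irrelevant). -/
def Sentence.Models {σ : FirstOrder.Language.{0, 0}} {𝒬 : Set Quantifier} (A : FinStr σ)
    (φ : Sentence σ 𝒬) : Prop :=
  ∀ α : Fin φ.numVars → A.carrier, φ.formula.Holds A α

/-- `𝓛(𝒬) ≤ 𝓛(𝒬')`: over every finite relational vocabulary, every sentence of `𝓛(𝒬)` is
equivalent, on finite structures, to a sentence of `𝓛(𝒬')`. -/
def LogicLE (𝒬 𝒬' : Set Quantifier) : Prop :=
  ∀ (σ : FirstOrder.Language.{0, 0}) [σ.IsRelational] [Finite (Σ n, σ.Relations n)] (φ : Sentence σ 𝒬),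
    ∃ ψ : Sentence σ 𝒬', ∀ A : FinStr σ, φ.Models A ↔ ψ.Models A

/-- `𝒬_r`: the quantifiers of arity at most `r`. -/
def quantifiersOfArity (r : ℕ) : Set Quantifier :=
  {Q | ∀ n, Nonempty (Q.voc.Relations n) → n ≤ r}

/-- The CSP quantifiers: the class is `{A | A → B}` for some template `B`. -/
def cspQuantifiers : Set Quantifier :=
  {Q | ∃ B : FinStr Q.voc, ∀ A : FinStr Q.voc,
    A ∈ Q.cls ↔ Nonempty (A.carrier →[Q.voc] B.carrier)}

/-- The relation `p(R)`, obtained from `R ⊆ Aⁿ` by applying the partial function `p` of arity `ℓ`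
columnwise to tuples in `R`. -/
def imageRel {A : Type} {ℓ n : ℕ} (p : (Fin ℓ → A) →. A) (R : (Fin n → A) → Prop) :
    (Fin n → A) → Prop :=
  fun b => ∃ a : Fin ℓ → Fin n → A, (∀ i, R (a i)) ∧ ∀ j, b j ∈ p (fun i => a i j)

/-- The quantifiers closed under the family `P` of partial functions: if `B` is in the class and
`A ≤ B ∪ P(B)` (on the same universe), then `A` is in the class. -/
def closedQuantifiers {ℓ : ℕ} (P : ∀ A : Type, (Fin ℓ → A) →. A) : Set Quantifier :=
  {Q | ∀ (U : Type) (hf : Finite U) (hn : Nonempty U) (A B : Q.voc.Structure U),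
    (⟨U, B, hf, hn⟩ : FinStr Q.voc) ∈ Q.cls →
    (∀ (n : ℕ) (R : Q.voc.Relations n) (x : Fin n → U),
      A.RelMap R x → B.RelMap R x ∨ imageRel (P U) (B.RelMap R) x) →
    (⟨U, A, hf, hn⟩ : FinStr Q.voc) ∈ Q.cls}

/-- The partial near-unanimity function of arity `ℓ`: its value is `c` if at least `ℓ - 1` of the
inputs are equal to `c`, and it is undefined if there is no such `c`. -/
noncomputable def nearUnanimity (ℓ : ℕ) (A : Type) : (Fin ℓ → A) →. A :=
  fun a => ⟨∃ c, ℓ ≤ {i | a i = c}.ncard + 1, fun h => h.choose⟩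

theorem mem_nearUnanimity {ℓ : ℕ} (hℓ : 3 ≤ ℓ) {A : Type} (a : Fin ℓ → A) (c : A) :
    c ∈ nearUnanimity ℓ A a ↔ ℓ ≤ {i | a i = c}.ncard + 1 := by
  constructor
  · rintro ⟨h, rfl⟩
    exact h.choose_spec
  · intro hc
    refine ⟨⟨c, hc⟩, ?_⟩
    have h : ∃ c, ℓ ≤ {i | a i = c}.ncard + 1 := ⟨c, hc⟩
    change h.choose = c
    have hd := h.choose_spec
    set d := h.choose
    by_contra hne
    have hdisj : Disjoint {i | a i = d} {i | a i = c} := by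
      rw [Set.disjoint_left]
      intro i hi hi'
      exact hne (hi.symm.trans hi')
    have h1 := Set.ncard_union_eq hdisj (Set.toFinite _) (Set.toFinite _)
    have h2 := Set.ncard_le_ncard (Set.subset_univ ({i | a i = d} ∪ {i | a i = c}))
      (Set.toFinite _)
    rw [Set.ncard_univ, Nat.card_fin] at h2
    omega

/-- The `𝒩^ℓ`-closed CSP quantifiers of arity at most `r`. -/
noncomputable def nuCSPQuantifiers (ℓ r : ℕ) : Set Quantifier :=
  closedQuantifiers (nearUnanimity ℓ) ∩ cspQuantifiers ∩ quantifiersOfArity r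

/-- `q(r, ℓ) = (2r+1)(⌊(2r+1)/(ℓ-1)⌋ + 2)` (used for `ℓ ≥ 3`). -/
def separationArity (r ℓ : ℕ) : ℕ :=
  (2 * r + 1) * ((2 * r + 1) / (ℓ - 1) + 2)

end PolyQuant

/-!
The construction is that of Cai, Fürer and Immerman. Over a `(2r+1)`-regular graph every edge
carries a bit, every vertex demands a parity of the bits of its edges, and a vertex demanding odd
parity carries a charge. The parities can be met exactly when the total charge is even, which is a
constraint satisfaction problem. To make its template closed under partial near-unanimity, the edges
at a vertex are coloured with `ℓ - 1` colours, and a tuple records the pairs of bits of edges of the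
same colour besides the single bits. If each entry of `ℓ` such tuples has at most one dissenter from
a common value but every tuple dissents somewhere, then two of them dissent at edges of the same
colour, hence at a common entry; so one of the tuples is the common value.

Adding a set of edges with boundary `{v, w}` moves a charge from `v` to `w`. An element of the
structure refers to at most two edges, so that a move of the `r`-bijective game touches at most `2r`
of them. On a discrete torus of dimension `2r` there are `2r + 1` edge-disjoint routes along which
the charge can escape, so the duplicator can hide it from all quantifiers of arity `r`.
-/

namespace PolyQuant

open FirstOrder.Language
open scoped FirstOrder Function

/-! ### Logics with generalized quantifiers -/

section Logic

variable {σ : FirstOrder.Language.{0, 0}} {𝒬 𝒬' : Set Quantifier}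

theorem Quantifier.mem_cls_iff_of_equiv (Q : Quantifier) {A B : FinStr Q.voc}
    (f : A.carrier ≃ B.carrier)
    (hf : ∀ {n : ℕ} (R : Q.voc.Relations n) (x : Fin n → A.carrier),
      Structure.RelMap R (f ∘ x) ↔ Structure.RelMap R x) : A ∈ Q.cls ↔ B ∈ Q.cls := by
  let g : A.carrier ≃[Q.voc] B.carrier :=
    { f with
      map_fun' := fun F => isEmptyElim F
      map_rel' := fun R x => hf R x }
  exact ⟨fun hA => Q.iso_closed A B hA ⟨g⟩, fun hB => Q.iso_closed B A hB ⟨g.symm⟩⟩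

/-- A formula over the quantifiers in `𝒬`, regarded as a formula over a larger set of
quantifiers. -/
def Formula.ofSubset (h : 𝒬 ⊆ 𝒬') {k : ℕ} : Formula σ 𝒬 k → Formula σ 𝒬' k
  | .eq x y => .eq x y
  | .rel R x => .rel R x
  | .neg φ => .neg (φ.ofSubset h)
  | .conj φ => .conj fun i => (φ i).ofSubset h
  | .ex x φ => .ex x (φ.ofSubset h)
  | .quant Q hQ y ψ => .quant Q (h hQ) y fun R => (ψ R).ofSubset h

theorem Formula.freeVars_ofSubset (h : 𝒬 ⊆ 𝒬') {k : ℕ} (φ : Formula σ 𝒬 k) :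
    (φ.ofSubset h).freeVars = φ.freeVars := by
  induction φ with
  | eq | rel => rfl
  | neg _ ih => exact ih
  | conj _ ih => exact Set.iUnion_congr ih
  | ex x _ ih => exact congrArg (· \ {x}) ih
  | quant _ _ y _ ih =>
    exact Set.iUnion₂_congr fun n R => congrArg (· \ Set.range (y R)) (ih R)

theorem Formula.holds_ofSubset (h : 𝒬 ⊆ 𝒬') {k : ℕ} (φ : Formula σ 𝒬 k) {A : FinStr σ}
    (α : Fin k → A.carrier) : (φ.ofSubset h).Holds A α ↔ φ.Holds A α := by
  induction φ generalizing α with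
  | eq | rel => rfl
  | neg _ ih => exact not_congr (ih α)
  | conj _ ih => exact forall_congr' fun i => ih i α
  | ex _ _ ih => exact exists_congr fun a => ih _
  | quant Q _ _ _ ih => exact Q.mem_cls_iff_of_equiv (Equiv.refl _) fun R b => (ih R _).symm

theorem LogicLE.of_subset (h : 𝒬 ⊆ 𝒬') : LogicLE 𝒬 𝒬' := fun _ _ _ φ =>
  ⟨⟨φ.numVars, φ.formula.ofSubset h, (φ.formula.freeVars_ofSubset h).trans φ.closed⟩,
    fun _ => forall_congr' fun α => (φ.formula.holds_ofSubset h α).symm⟩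

theorem LogicLE.trans {𝒬'' : Set Quantifier} (h : LogicLE 𝒬 𝒬') (h' : LogicLE 𝒬' 𝒬'') :
    LogicLE 𝒬 𝒬'' := by
  intro σ _ _ φ
  obtain ⟨ψ, hψ⟩ := h σ φ
  obtain ⟨χ, hχ⟩ := h' σ ψ
  exact ⟨χ, fun A => (hψ A).trans (hχ A)⟩

theorem Quantifier.exists_sentence_models_iff (Q : Quantifier) (hQ : Q ∈ 𝒬) :
    ∃ φ : Sentence Q.voc 𝒬, ∀ A : FinStr Q.voc, φ.Models A ↔ A ∈ Q.cls := by
  obtain ⟨k, hk⟩ := (Set.finite_range fun R : Σ n, Q.voc.Relations n => R.1).bddAbove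
  have hle {n : ℕ} (R : Q.voc.Relations n) : n ≤ k := hk ⟨⟨n, R⟩, rfl⟩
  let y {n : ℕ} (R : Q.voc.Relations n) : Fin n ↪ Fin k := Fin.castLEEmb (hle R)
  let φ : Formula Q.voc 𝒬 k := .quant Q hQ y fun R => .rel R (y R)
  have hfree : φ.freeVars = ∅ := Set.iUnion_eq_empty.mpr fun _ => Set.iUnion_eq_empty.mpr
    fun _ => sdiff_self
  have hholds {A : FinStr Q.voc} (α : Fin k → A.carrier) : φ.Holds A α ↔ A ∈ Q.cls := by
    refine Q.mem_cls_iff_of_equiv (Equiv.refl _) fun R x => ?_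
    have hx : (fun i => Function.extend (y R) x α (y R i)) = x :=
      Function.extend_comp (y R).injective x α
    exact iff_of_eq (congrArg (A.str.RelMap R) hx.symm)
  refine ⟨⟨k, φ, hfree⟩, fun A => ⟨fun h => ?_, fun hA α => (hholds α).mpr hA⟩⟩
  exact (hholds fun _ => Classical.arbitrary A.carrier).mp (h _)

/-- The CSP quantifier with template `B`. -/
def cspQuantifier [σ.IsRelational] [Finite (Σ n, σ.Relations n)] (B : FinStr σ) : Quantifier where
  voc := σ
  relational := inferInstance
  finite_voc := inferInstance
  cls := {A | Nonempty (A.carrier →[σ] B.carrier)}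
  iso_closed := fun _ _ ⟨f⟩ ⟨g⟩ => ⟨f.comp g.symm.toHom⟩

theorem mem_cspQuantifier_iff [σ.IsRelational] [Finite (Σ n, σ.Relations n)] {A B : FinStr σ} :
    A ∈ (cspQuantifier B).cls ↔ ∃ h : A.carrier → B.carrier, ∀ (n : ℕ) (R : σ.Relations n)
      (x : Fin n → A.carrier), Structure.RelMap R x → Structure.RelMap R (h ∘ x) :=
  ⟨fun ⟨f⟩ => ⟨f, fun _ => f.map_rel⟩,
    fun ⟨h, hh⟩ => ⟨⟨h, fun F => isEmptyElim F, fun R x => hh _ R x⟩⟩⟩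

theorem cspQuantifier_mem_closedQuantifiers [σ.IsRelational] [Finite (Σ n, σ.Relations n)]
    {ℓ : ℕ} {P : ∀ A : Type, (Fin ℓ → A) →. A}
    (hP : ∀ {U V : Type} (h : U → V) {a : Fin ℓ → U} {c : U}, c ∈ P U a → h c ∈ P V (h ∘ a))
    {B : FinStr σ} (hB : ∀ {n : ℕ} (R : σ.Relations n) (b : Fin n → B.carrier),
      imageRel (P B.carrier) (Structure.RelMap R) b → Structure.RelMap R b) :
    cspQuantifier B ∈ closedQuantifiers P := by
  intro U _ _ A A' hA' hA
  obtain ⟨h, hh⟩ := mem_cspQuantifier_iff.mp hA'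
  refine mem_cspQuantifier_iff.mpr ⟨h, fun n R x hx => ?_⟩
  obtain hx | ⟨a, ha, hax⟩ := hA n R x hx
  · exact hh n R x hx
  · exact hB R _ ⟨fun t => h ∘ a t, fun t => hh n R _ (ha t), fun j => hP h (hax j)⟩

end Logic

/-! ### The bijective game -/

theorem update_eq_extend {ι X A : Type*} [Nonempty ι] [Subsingleton ι] [DecidableEq X]
    (α : X → A) (x : X) (a : A) :
    Function.update α x a = Function.extend (fun _ : ι => x) (fun _ => a) α := by
  ext x'
  obtain rfl | hx' := eq_or_ne x' x
  · rw [Function.update_self]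
    have hinj : Function.Injective fun _ : ι => x' := Function.injective_of_subsingleton _
    exact (hinj.extend_apply (fun _ => a) α (Classical.arbitrary ι)).symm
  · rw [Function.update_of_ne hx', Function.extend_apply' _ _ _ fun ⟨_, h⟩ => hx' h.symm]

/-- A winning strategy for the duplicator in the `r`-bijective `k`-pebble game: a set `W` of
positions that preserve atoms, in which the duplicator can answer every move with a bijection. The
spoiler starts by pebbling a tuple of the second structure. -/
structure BijectiveStrategy {σ : FirstOrder.Language.{0, 0}} (A B : FinStr σ) (r k : ℕ)
    (W : (Fin k → A.carrier) → (Fin k → B.carrier) → Prop) : Prop where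
  start : ∀ β, ∃ α, W α β
  eq_iff : ∀ {α β}, W α β → ∀ x y, α x = α y ↔ β x = β y
  rel_iff : ∀ {α β}, W α β → ∀ {n : ℕ} (R : σ.Relations n) (x : Fin n → Fin k),
    Structure.RelMap R (α ∘ x) ↔ Structure.RelMap R (β ∘ x)
  bijection : ∀ {α β}, W α β → ∃ f : A.carrier ≃ B.carrier, ∀ n ≤ r, ∀ (y : Fin n ↪ Fin k)
    (b : Fin n → A.carrier), W (Function.extend y b α) (Function.extend y (f ∘ b) β)

namespace BijectiveStrategy

variable {σ : FirstOrder.Language.{0, 0}} {A B : FinStr σ} {r k : ℕ}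
  {W : (Fin k → A.carrier) → (Fin k → B.carrier) → Prop}

theorem holds_iff (h : BijectiveStrategy A B r k W) (hr : 0 < r)
    (φ : Formula σ (quantifiersOfArity r) k) {α : Fin k → A.carrier} {β : Fin k → B.carrier}
    (hW : W α β) : φ.Holds A α ↔ φ.Holds B β := by
  induction φ generalizing α β with
  | eq x y => exact h.eq_iff hW x y
  | rel R x => exact h.rel_iff hW R x
  | neg _ ih => exact not_congr (ih hW)
  | conj _ ih => exact forall_congr' fun i => ih i hW
  | ex x φ ih =>
    obtain ⟨f, hf⟩ := h.bijection hW
    refine f.exists_congr fun a => ih ?_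
    rw [update_eq_extend (ι := Fin 1), update_eq_extend (ι := Fin 1)]
    exact hf 1 hr ⟨fun _ => x, Function.injective_of_subsingleton _⟩ fun _ => a
  | quant Q hQ y _ ih =>
    obtain ⟨f, hf⟩ := h.bijection hW
    exact Q.mem_cls_iff_of_equiv f fun {n} R b => (ih R (hf n (hQ n ⟨R⟩) (y R) b)).symm

theorem models {φ : Sentence σ (quantifiersOfArity r)}
    {W : (Fin φ.numVars → A.carrier) → (Fin φ.numVars → B.carrier) → Prop}
    (h : BijectiveStrategy A B r φ.numVars W) (hr : 0 < r) (hA : φ.Models A) : φ.Models B := by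
  intro β
  obtain ⟨α, hW⟩ := h.start β
  exact (h.holds_iff hr φ.formula hW).mp (hA α)

end BijectiveStrategy

theorem not_logicLE_of_bijectiveStrategy {𝒬 : Set Quantifier} {Q : Quantifier} (hQ : Q ∈ 𝒬) {r : ℕ}
    (hr : 0 < r) (h : ∀ k, ∃ A ∈ Q.cls, ∃ B ∉ Q.cls, ∃ W, BijectiveStrategy A B r k W) :
    ¬ LogicLE 𝒬 (quantifiersOfArity r) := by
  intro hle
  obtain ⟨φ, hφ⟩ := Q.exists_sentence_models_iff hQ
  obtain ⟨ψ, hψ⟩ := hle Q.voc φ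
  obtain ⟨A, hA, B, hB, W, hW⟩ := h ψ.numVars
  have hψQ (A) : ψ.Models A ↔ A ∈ Q.cls := (hψ A).symm.trans (hφ A)
  exact hB ((hψQ B).mp (hW.models hr ((hψQ A).mpr hA)))

/-! ### Structures with a single relation -/

section SingleRelation

variable {ι : Type*} [Fintype ι] {U V : Type} [Finite U] [Nonempty U] [Finite V] [Nonempty V]

/-- The vocabulary with a single relation symbol, whose arguments are indexed by `ι`. -/
abbrev singleLang (ι : Type*) [Fintype ι] : FirstOrder.Language.{0, 0} :=
  ⟨fun _ => Empty, fun n => PLift (n = Fintype.card ι)⟩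

instance : (singleLang ι).IsRelational := fun _ => inferInstanceAs (IsEmpty Empty)

instance : Finite (Σ n, (singleLang ι).Relations n) := by
  refine Finite.of_injective (β := Unit) (fun _ => ()) ?_
  rintro ⟨_, ⟨rfl⟩⟩ ⟨_, ⟨rfl⟩⟩ _
  rfl

/-- The structure over `singleLang ι` on the universe `U` whose relation consists of the tuples in
`S`. -/
noncomputable def singleStr (U : Type) [Finite U] [Nonempty U] (S : Set (ι → U)) :
    FinStr (singleLang ι) :=
  ⟨U, relStructure (singleLang ι) U fun R x => x ∘ Fin.cast R.down.symm ∘ Fintype.equivFin ι ∈ S,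
    ‹_›, ‹_›⟩

theorem singleStr_mem_cspQuantifier_iff {S : Set (ι → U)} {T : Set (ι → V)} :
    singleStr U S ∈ (cspQuantifier (singleStr V T)).cls ↔ ∃ h : U → V, ∀ x ∈ S, h ∘ x ∈ T := by
  refine mem_cspQuantifier_iff.trans (exists_congr fun h => ⟨fun hh x hx => ?_, ?_⟩)
  · have hcast : (x ∘ (Fintype.equivFin ι).symm) ∘ Fintype.equivFin ι = x := by
      rw [Function.comp_assoc, Equiv.symm_comp_self, Function.comp_id]
    have hhx := hh _ ⟨rfl⟩ (x ∘ (Fintype.equivFin ι).symm)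
      (hcast.symm ▸ hx : (x ∘ (Fintype.equivFin ι).symm) ∘ Fintype.equivFin ι ∈ S)
    exact (congrArg (h ∘ ·) hcast ▸ hhx : h ∘ x ∈ T)
  · exact fun hh _ _ _ hx => hh _ hx

theorem cspQuantifier_singleStr_mem_quantifiersOfArity {T : Set (ι → V)} {r : ℕ}
    (hr : Fintype.card ι ≤ r) : cspQuantifier (singleStr V T) ∈ quantifiersOfArity r := by
  rintro _ ⟨⟨rfl⟩⟩
  exact hr

theorem cspQuantifier_singleStr_mem_closedQuantifiers {ℓ : ℕ} {P : ∀ A : Type, (Fin ℓ → A) →. A}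
    (hP : ∀ {U V : Type} (h : U → V) {a : Fin ℓ → U} {c : U}, c ∈ P U a → h c ∈ P V (h ∘ a))
    {T : Set (ι → V)} (hT : ∀ a : Fin ℓ → ι → V, (∀ t, a t ∈ T) →
      ∀ b, (∀ i, b i ∈ P V fun t => a t i) → b ∈ T) :
    cspQuantifier (singleStr V T) ∈ closedQuantifiers P :=
  cspQuantifier_mem_closedQuantifiers hP fun _ _ ⟨_, ha, hb⟩ => hT _ ha _ fun _ => hb _

end SingleRelation

/-! ### Partial near-unanimity -/

section NearUnanimity

variable {ℓ : ℕ} {A B : Type} {a : Fin ℓ → A} {c : A}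

theorem mem_nearUnanimity_iff_subsingleton (hℓ : 3 ≤ ℓ) :
    c ∈ nearUnanimity ℓ A a ↔ {t | a t ≠ c}.Subsingleton := by
  rw [mem_nearUnanimity hℓ, ← Set.ncard_le_one_iff_subsingleton]
  have hcompl : {t | a t ≠ c} = {t | a t = c}ᶜ := rfl
  have hadd := Set.ncard_add_ncard_compl {t | a t = c}
  rw [Nat.card_fin] at hadd
  rw [hcompl]
  omega

theorem apply_mem_nearUnanimity (hℓ : 3 ≤ ℓ) (h : A → B) (hc : c ∈ nearUnanimity ℓ A a) :
    h c ∈ nearUnanimity ℓ B (h ∘ a) := by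
  rw [mem_nearUnanimity_iff_subsingleton hℓ] at hc ⊢
  exact hc.anti fun t => mt (congrArg h)

end NearUnanimity

theorem exists_notMem_notMem_of_subsingleton {ι : Type*} [Fintype ι] (hι : 3 ≤ Fintype.card ι)
    {s t : Set ι} (hs : s.Subsingleton) (ht : t.Subsingleton) : ∃ i, i ∉ s ∧ i ∉ t := by
  by_contra! h
  have hunion : s ∪ t = Set.univ := Set.eq_univ_of_forall fun i => or_iff_not_imp_left.mpr (h i)
  have hcard := Set.ncard_union_le s t
  rw [hunion, Set.ncard_univ, Nat.card_eq_fintype_card] at hcard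
  have := Set.ncard_le_one_iff_subsingleton.mpr hs
  have := Set.ncard_le_one_iff_subsingleton.mpr ht
  omega

/-! ### Parity constraints -/

/-- The entries of a tuple that encodes a bit string indexed by `ι`: for each index there are two
entries for the bit and its negation, and one entry for each pair with another index of the same
colour. -/
abbrev Coord {ι C : Type*} (col : ι → C) := Σ i, ZMod 2 ⊕ {j // j ≠ i ∧ col j = col i}

/-- The bits that an edge can carry, and the pairs of bits that a pair of edges can carry. -/
abbrev EdgeBits (E : Type*) := (E × ZMod 2) ⊕ (E × E) × ZMod 2 × ZMod 2

section ParityTuples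

variable {ι C E V : Type*} (col : ι → C)

/-- The tuple recording that the edges `e i` carry the bits `x i`. -/
def edgeTuple (e : ι → E) (x : ι → ZMod 2) : Coord col → EdgeBits E
  | ⟨i, .inl s⟩ => .inl (e i, x i + s)
  | ⟨i, .inr j⟩ => .inr ((e i, e j), x i, x j)

/-- The relation of the parity constraints on a graph in which the edges at the vertex `v` are
`inc v i`: the bits of the edges at `v` have the sum `b v`. -/
def parityTuples [Fintype ι] (inc : V → ι → E) (b : V → ZMod 2) : Set (Coord col → EdgeBits E) :=
  {t | ∃ v x, ∑ i, x i = b v ∧ t = edgeTuple col (inc v) x}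

variable {col}

theorem exists_eq_edgeTuple_of_subsingleton {T : Type*} [Fintype T] (hT : 3 ≤ Fintype.card T)
    {x : T → ι → ZMod 2} {b : Coord col → EdgeBits Unit}
    (hb : ∀ j, {t | edgeTuple col (fun _ => ()) (x t) j ≠ b j}.Subsingleton) :
    ∃ y, b = edgeTuple col (fun _ => ()) y := by
  have hy (i) : ∃ c, b ⟨i, .inl 0⟩ = .inl ((), c) := by
    obtain ⟨t, ht, -⟩ := exists_notMem_notMem_of_subsingleton hT (hb ⟨i, .inl 0⟩) (hb ⟨i, .inl 0⟩)
    exact ⟨_, (not_not.mp ht).symm⟩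
  choose y hy using hy
  have hxy (i) : {t | x t i ≠ y i}.Subsingleton :=
    (hb ⟨i, .inl 0⟩).anti fun t => by simp [hy, edgeTuple]
  refine ⟨y, funext fun ⟨i, s⟩ => ?_⟩
  obtain ⟨t, hbt, hxt⟩ := exists_notMem_notMem_of_subsingleton hT (hb ⟨i, s⟩) (hxy i)
  replace hbt := not_not.mp hbt
  replace hxt := not_not.mp hxt
  obtain s | j := s
  · rw [← hbt, edgeTuple, edgeTuple, hxt]
  · obtain ⟨t', hbt', hxt'⟩ := exists_notMem_notMem_of_subsingleton hT (hb ⟨i, .inr j⟩) (hxy j)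
    have htt' := hbt.trans (not_not.mp hbt').symm
    simp only [edgeTuple, Sum.inr.injEq, Prod.mk.injEq] at htt'
    rw [← hbt, edgeTuple, edgeTuple, hxt, htt'.2.2, not_not.mp hxt']

theorem exists_eq_of_subsingleton [Fintype C] {T : Type*} [Fintype T]
    (hCT : Fintype.card C < Fintype.card T) {x : T → ι → ZMod 2} {y : ι → ZMod 2} (hxy : ∀ j,
      {t | edgeTuple col (fun _ => ()) (x t) j ≠ edgeTuple col (fun _ => ()) y j}.Subsingleton) :
    ∃ t, x t = y := by
  by_contra! h
  choose i hi using fun t => Function.ne_iff.mp (h t)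
  obtain ⟨s, t, hst, hcol⟩ := Fintype.exists_ne_map_eq_of_card_lt (fun t => col (i t)) hCT
  obtain hij | hij := eq_or_ne (i t) (i s)
  · refine hst (hxy ⟨i s, .inl 0⟩ ?_ ?_)
    · simpa [edgeTuple] using hi s
    · simpa [edgeTuple, ← hij] using hi t
  · refine hst (hxy ⟨i s, .inr ⟨i t, hij, hcol.symm⟩⟩ ?_ ?_)
    · exact fun h => hi s (by simp_all [edgeTuple])
    · exact fun h => hi t (by simp_all [edgeTuple])

/-- The relation of the template: the parity constraint of the graph with one vertex and one edge,
in which all entries of a tuple refer to that edge. -/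
abbrev evenTuples [Fintype ι] (col : ι → C) : Set (Coord col → EdgeBits Unit) :=
  parityTuples col (fun (_ : Unit) _ => ()) 0

theorem cspQuantifier_evenTuples_mem_nuCSPQuantifiers [Fintype ι] [Fintype C]
    [Fintype (Coord col)] {ℓ r : ℕ} (hℓ : 3 ≤ ℓ) (hC : Fintype.card C < ℓ)
    (hr : Fintype.card (Coord col) ≤ r) :
    cspQuantifier (singleStr _ (evenTuples col)) ∈ nuCSPQuantifiers ℓ r := by
  refine ⟨⟨?_, ⟨_, fun _ => Iff.rfl⟩⟩, cspQuantifier_singleStr_mem_quantifiersOfArity hr⟩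
  refine cspQuantifier_singleStr_mem_closedQuantifiers
    (fun h _ _ => apply_mem_nearUnanimity hℓ h) ?_
  intro a ha b hb
  choose v x hx hax using ha
  obtain rfl : a = _ := funext hax
  simp only [mem_nearUnanimity_iff_subsingleton hℓ] at hb
  obtain ⟨y, rfl⟩ := exists_eq_edgeTuple_of_subsingleton (by rwa [Fintype.card_fin]) hb
  obtain ⟨t, rfl⟩ := exists_eq_of_subsingleton (by rwa [Fintype.card_fin]) hb
  exact ⟨(), x t, hx t, rfl⟩

end ParityTuples

section Coloring

variable {ι : Type*} [Fintype ι]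

theorem card_coord_le {C : Type*} [DecidableEq ι] [DecidableEq C] {col : ι → C} {d : ℕ}
    (hcol : ∀ c, Fintype.card {i // col i = c} ≤ d + 1) :
    Fintype.card (Coord col) ≤ Fintype.card ι * (d + 2) := by
  have hpart (i : ι) : Fintype.card {j // j ≠ i ∧ col j = col i} ≤ d := by
    refine Nat.le_of_lt_succ ((Fintype.card_lt_of_injective_of_notMem
      (fun j => ⟨j.1, j.2.2⟩ : {j // j ≠ i ∧ col j = col i} → {j // col j = col i})
      (fun j j' h => Subtype.ext (congrArg (fun j => j.1) h)) (b := ⟨i, rfl⟩) ?_).trans_le (hcol _))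
    rintro ⟨j, hj⟩
    exact j.2.1 (congrArg Subtype.val hj)
  rw [Fintype.card_sigma, ← smul_eq_mul, ← Finset.card_univ]
  refine Finset.sum_le_card_nsmul _ _ _ fun i _ => ?_
  rw [Fintype.card_sum, ZMod.card]
  have := hpart i
  omega

theorem exists_coloring_card_fiber_le {p : ℕ} (hp : 0 < p) :
    ∃ col : ι → Fin p, ∀ c, Fintype.card {i // col i = c} ≤ Fintype.card ι / p + 1 := by
  let e := Fintype.equivFin ι
  refine ⟨fun i => ⟨e i % p, Nat.mod_lt _ hp⟩, fun c => ?_⟩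
  let quot (i : {i // (⟨e i % p, Nat.mod_lt _ hp⟩ : Fin p) = c}) : Fin (Fintype.card ι / p + 1) :=
    ⟨e i / p, Nat.lt_succ_of_le (Nat.div_le_div_right (e i).isLt.le)⟩
  refine (Fintype.card_le_of_injective quot ?_).trans_eq (Fintype.card_fin _)
  rintro ⟨i, rfl⟩ ⟨j, hj⟩ hij
  have hmod : (e j : ℕ) % p = e i % p := congrArg Fin.val hj
  have hdiv : (e i : ℕ) / p = e j / p := congrArg Fin.val hij
  exact Subtype.ext (e.injective (Fin.ext (Nat.ext_div_mod hdiv hmod.symm)))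

end Coloring

/-! ### Boundaries and flows -/

section Flow

variable {ι E V : Type*} [Fintype ι]

/-- The `ZMod 2`-boundary of the set of edges with indicator function `c`. -/
def boundary (inc : V → ι → E) (c : E → ZMod 2) (v : V) : ZMod 2 := ∑ i, c (inc v i)

theorem boundary_add (inc : V → ι → E) (c c' : E → ZMod 2) :
    boundary inc (c + c') = boundary inc c + boundary inc c' :=
  funext fun _ => Finset.sum_add_distrib

/-- There is a set of edges, disjoint from `F`, with boundary `{v, w}`. -/
def Flow [DecidableEq V] (inc : V → ι → E) (F : Finset E) (v w : V) : Prop :=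
  ∃ c : E → ZMod 2, (∀ e ∈ F, c e = 0) ∧ boundary inc c = Pi.single v 1 + Pi.single w 1

namespace Flow

variable [DecidableEq V] {inc : V → ι → E} {F : Finset E} {u v w : V}

theorem refl : Flow inc F v v :=
  ⟨0, fun _ _ => rfl, (funext fun _ => Finset.sum_const_zero).trans
    (ZModModule.add_self (Pi.single v 1 : V → ZMod 2)).symm⟩

theorem symm : Flow inc F v w → Flow inc F w v :=
  fun ⟨c, hc, h⟩ => ⟨c, hc, h.trans (add_comm _ _)⟩

theorem trans : Flow inc F u v → Flow inc F v w → Flow inc F u w := by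
  rintro ⟨c, hc, h⟩ ⟨c', hc', h'⟩
  refine ⟨c + c', fun e he => ?_, ?_⟩
  · rw [Pi.add_apply, hc e he, hc' e he, add_zero]
  · rw [boundary_add, h, h', ZModModule.add_add_add_cancel]

end Flow

end Flow

/-! ### Parity structures -/

section ParityStructures

variable {ι C E V : Type*}

/-- Adding the set of edges with indicator function `c` to the bits. -/
def flipBits (c : E → ZMod 2) : EdgeBits E → EdgeBits E
  | .inl (e, a) => .inl (e, a + c e)
  | .inr ((e, e'), a, a') => .inr ((e, e'), a + c e, a' + c e')

theorem flipBits_involutive (c : E → ZMod 2) : Function.Involutive (flipBits c) := by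
  rintro (⟨e, a⟩ | ⟨⟨e, e'⟩, a, a'⟩) <;> simp [flipBits, add_assoc, CharTwo.add_self_eq_zero]

theorem flipBits_comp_edgeTuple {col : ι → C} (c : E → ZMod 2) (e : ι → E) (x : ι → ZMod 2) :
    flipBits c ∘ edgeTuple col e x = edgeTuple col e (x + c ∘ e) := by
  ext1 ⟨i, s | j⟩
  · simp [edgeTuple, flipBits, add_right_comm]
  · rfl

theorem exists_map_mem_evenTuples_iff [Fintype ι] [Nonempty ι] {col : ι → C} {inc : V → ι → E}
    {b : V → ZMod 2} :
    (∃ h : EdgeBits E → EdgeBits Unit, ∀ t ∈ parityTuples col inc b, h ∘ t ∈ evenTuples col) ↔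
      ∃ c, boundary inc c = b := by
  classical
  constructor
  · rintro ⟨h, hh⟩
    refine ⟨fun e => (h (.inl (e, 0))).elim Prod.snd 0, funext fun v => ?_⟩
    obtain ⟨i₀⟩ := ‹Nonempty ι›
    have hsum : ∑ i, (Pi.single i₀ (b v) : ι → ZMod 2) i = b v := Fintype.sum_pi_single' _ _
    set x : ι → ZMod 2 := Pi.single i₀ (b v)
    obtain ⟨_, y, hy, hxy⟩ := hh _ ⟨v, x, hsum, rfl⟩
    have hval (i) : h (.inl (inc v i, 0)) = .inl ((), y i + x i) := by
      simpa [edgeTuple, CharTwo.add_self_eq_zero] using congrFun hxy ⟨i, .inl (x i)⟩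
    simp only [boundary, hval, Sum.elim_inl, Finset.sum_add_distrib, hy, hsum, Pi.zero_apply,
      zero_add]
  · rintro ⟨c, rfl⟩
    let forget : EdgeBits E → EdgeBits Unit :=
      Sum.map (Prod.map (fun _ => ()) id) (Prod.map (fun _ => ((), ())) id)
    refine ⟨forget ∘ flipBits c, ?_⟩
    rintro _ ⟨v, x, hx, rfl⟩
    refine ⟨(), x + c ∘ inc v, ?_, ?_⟩
    · exact Finset.sum_add_distrib.trans (hx ▸ CharTwo.add_self_eq_zero _)
    · rw [Function.comp_assoc, flipBits_comp_edgeTuple]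
      ext1 ⟨i, s | j⟩ <;> rfl

variable [DecidableEq E]

/-- The edges to which an element refers. -/
def edgesOf : EdgeBits E → Finset E
  | .inl (e, _) => {e}
  | .inr ((e, e'), _) => {e, e'}

theorem card_edgesOf_le (a : EdgeBits E) : (edgesOf a).card ≤ 2 := by
  obtain ⟨e, _⟩ | ⟨⟨e, e'⟩, _⟩ := a
  · exact (Finset.card_singleton e).trans_le one_le_two
  · exact Finset.card_le_two

theorem edgesOf_flipBits (c : E → ZMod 2) (a : EdgeBits E) :
    edgesOf (flipBits c a) = edgesOf a := by
  obtain ⟨e, _⟩ | ⟨⟨e, e'⟩, _, _⟩ := a <;> rfl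

theorem flipBits_add_of_forall_edgesOf (c : E → ZMod 2) {c' : E → ZMod 2} {a : EdgeBits E}
    (h : ∀ e ∈ edgesOf a, c' e = 0) : flipBits (c + c') a = flipBits c a := by
  obtain ⟨e, _⟩ | ⟨⟨e, e'⟩, _, _⟩ := a <;> simp_all [flipBits, edgesOf]

/-- The edges to which the elements of a tuple refer. -/
def tupleEdges {n : ℕ} (α : Fin n → EdgeBits E) : Finset E :=
  Finset.univ.biUnion fun i => edgesOf (α i)

section TupleEdges

variable {k n : ℕ} {α : Fin k → EdgeBits E}

theorem edgesOf_subset_tupleEdges (i : Fin k) : edgesOf (α i) ⊆ tupleEdges α :=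
  Finset.subset_biUnion_of_mem (fun i => edgesOf (α i)) (Finset.mem_univ i)

theorem card_tupleEdges_le (α : Fin k → EdgeBits E) : (tupleEdges α).card ≤ 2 * k := by
  rw [mul_comm]
  simpa [tupleEdges] using Finset.card_biUnion_le_card_mul Finset.univ (fun i => edgesOf (α i)) 2
    fun i _ => card_edgesOf_le _

theorem tupleEdges_flipBits (c : E → ZMod 2) : tupleEdges (flipBits c ∘ α) = tupleEdges α := by
  simp only [tupleEdges, Function.comp_apply, edgesOf_flipBits]

theorem flipBits_add_comp (c : E → ZMod 2) {c' : E → ZMod 2} (h : ∀ e ∈ tupleEdges α, c' e = 0) :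
    flipBits (c + c') ∘ α = flipBits c ∘ α :=
  funext fun i => flipBits_add_of_forall_edgesOf c fun e he => h e (edgesOf_subset_tupleEdges i he)

theorem tupleEdges_extend_subset (y : Fin n ↪ Fin k) (b : Fin n → EdgeBits E) :
    tupleEdges (Function.extend y b α) ⊆ tupleEdges α ∪ tupleEdges b := by
  refine Finset.biUnion_subset.mpr fun i _ => ?_
  by_cases hi : ∃ j, y j = i
  · obtain ⟨j, rfl⟩ := hi
    rw [y.injective.extend_apply]
    exact (edgesOf_subset_tupleEdges j).trans Finset.subset_union_right
  · rw [Function.extend_apply' _ _ _ hi]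
    exact (edgesOf_subset_tupleEdges i).trans Finset.subset_union_left

end TupleEdges

end ParityStructures

/-! ### Hiding a charge -/

section Charge

variable {ι C E V : Type*} [Fintype ι] [DecidableEq E] [DecidableEq V] {inc : V → ι → E}

/-- A strategy for hiding a charge on a graph on which at most `2 * k` edges are blocked: the charge
rests at a vertex that is safe for the set of blocked edges. Before up to `2 * r` further edges are
blocked it can move to a vertex `z` that admits an escape to a safe vertex whatever these edges
are. -/
structure EvasionStrategy (inc : V → ι → E) (r k : ℕ) (Safe : Finset E → V → Prop) : Prop where
  exists_notMem : ∀ {F v}, Safe F v → ∃ i, inc v i ∉ F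
  start : ∀ {F}, F.card ≤ 2 * k → ∀ u, ∃ w, Safe F w ∧ Flow inc ∅ u w
  evade : ∀ {F w}, F.card ≤ 2 * k → Safe F w → ∃ z, Flow inc F w z ∧
    ∀ {F' G : Finset E}, F' ⊆ F ∪ G → F'.card ≤ 2 * k → G.card ≤ 2 * r →
      ∃ w', Safe F' w' ∧ Flow inc F' z w'

/-- The positions in which the two tuples differ by a flip that moves the charge from `u` to a safe
vertex. -/
def FlipPosition (inc : V → ι → E) (Safe : Finset E → V → Prop) (u : V) {k : ℕ}
    (α β : Fin k → EdgeBits E) : Prop :=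
  ∃ c w, β = flipBits c ∘ α ∧ boundary inc c = Pi.single u 1 + Pi.single w 1 ∧
    Safe (tupleEdges α) w

variable {r k : ℕ} {Safe : Finset E → V → Prop} {u : V} {α β : Fin k → EdgeBits E}

theorem FlipPosition.symm (h : FlipPosition inc Safe u α β) : FlipPosition inc Safe u β α := by
  obtain ⟨c, w, rfl, hc, hw⟩ := h
  refine ⟨c, w, ?_, hc, by rwa [tupleEdges_flipBits]⟩
  rw [← Function.comp_assoc, (flipBits_involutive c).comp_self, Function.id_comp]

theorem flipBits_comp_mem_parityTuples {col : ι → C} {b b' : V → ZMod 2} {c : E → ZMod 2} {w : V}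
    (hc : b + boundary inc c = b' + Pi.single w 1) (hw : ∃ i, inc w i ∉ tupleEdges α)
    {x : Coord col → Fin k} (h : α ∘ x ∈ parityTuples col inc b) :
    (flipBits c ∘ α) ∘ x ∈ parityTuples col inc b' := by
  obtain ⟨v, y, hy, hxy⟩ := h
  have hvw : v ≠ w := by
    rintro rfl
    obtain ⟨i, hi⟩ := hw
    have hα : α (x ⟨i, .inl 0⟩) = .inl (inc v i, y i + 0) := congrFun hxy ⟨i, .inl 0⟩
    refine hi (edgesOf_subset_tupleEdges (x ⟨i, .inl 0⟩) ?_)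
    rw [hα]
    exact Finset.mem_singleton_self _
  refine ⟨v, y + c ∘ inc v, ?_, ?_⟩
  · have hcv : b v + boundary inc c v = b' v := by
      simpa [Pi.single_eq_of_ne hvw] using congrFun hc v
    exact (Finset.sum_add_distrib.trans (congrArg (· + _) hy)).trans hcv
  · rw [Function.comp_assoc, hxy, flipBits_comp_edgeTuple]

namespace EvasionStrategy

theorem mem_parityTuples_iff (h : EvasionStrategy inc r k Safe) {col : ι → C}
    (hαβ : FlipPosition inc Safe u α β) {x : Coord col → Fin k} :
    α ∘ x ∈ parityTuples col inc 0 ↔ β ∘ x ∈ parityTuples col inc (Pi.single u 1) := by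
  constructor
  · obtain ⟨c, w, rfl, hc, hw⟩ := hαβ
    exact flipBits_comp_mem_parityTuples (by rw [hc, zero_add]) (h.exists_notMem hw)
  · obtain ⟨c, w, rfl, hc, hw⟩ := hαβ.symm
    refine flipBits_comp_mem_parityTuples ?_ (h.exists_notMem hw)
    rw [hc, ← add_assoc, ZModModule.add_self]

theorem exists_flipPosition (h : EvasionStrategy inc r k Safe) (u : V)
    (β : Fin k → EdgeBits E) : ∃ α, FlipPosition inc Safe u α β := by
  obtain ⟨w, hw, c, -, hc⟩ := h.start (card_tupleEdges_le β) u
  exact ⟨flipBits c ∘ β, FlipPosition.symm ⟨c, w, rfl, hc, hw⟩⟩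

theorem exists_flipPosition_extend (h : EvasionStrategy inc r k Safe)
    (hαβ : FlipPosition inc Safe u α β) :
    ∃ c, ∀ n ≤ r, ∀ (y : Fin n ↪ Fin k) (b : Fin n → EdgeBits E),
      FlipPosition inc Safe u (Function.extend y b α) (Function.extend y (flipBits c ∘ b) β) := by
  obtain ⟨c, w, rfl, hc, hw⟩ := hαβ
  obtain ⟨z, ⟨c', hc'F, hc'⟩, hz⟩ := h.evade (card_tupleEdges_le α) hw
  refine ⟨c + c', fun n hn y b => ?_⟩
  obtain ⟨w', hw', c'', hc''F, hc''⟩ := hz (tupleEdges_extend_subset y b) (card_tupleEdges_le _)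
    ((card_tupleEdges_le b).trans (Nat.mul_le_mul_left 2 hn))
  refine ⟨c + c' + c'', w', ?_, ?_, hw'⟩
  · rw [flipBits_add_comp _ hc''F, ← flipBits_add_comp c hc'F]
    exact (funext fun i => Function.apply_extend (flipBits (c + c')) _ _ i).symm
  · rw [boundary_add, boundary_add, hc, hc', hc'', ZModModule.add_add_add_cancel,
      ZModModule.add_add_add_cancel]

end EvasionStrategy

end Charge

theorem EvasionStrategy.bijectiveStrategy {ι C V : Type*} {E : Type} [Fintype ι] [DecidableEq E]
    [Finite E] [Nonempty E] [DecidableEq V] {inc : V → ι → E} {r k : ℕ}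
    {Safe : Finset E → V → Prop} (h : EvasionStrategy inc r k Safe) (col : ι → C)
    [Fintype (Coord col)] (u : V) :
    BijectiveStrategy (singleStr (EdgeBits E) (parityTuples col inc 0))
      (singleStr (EdgeBits E) (parityTuples col inc (Pi.single u 1))) r k
      (FlipPosition inc Safe u) where
  start := h.exists_flipPosition u
  eq_iff := by
    rintro α _ ⟨c, w, rfl, -, -⟩ x y
    exact (flipBits_involutive c).injective.eq_iff.symm
  rel_iff hαβ _ _ _ := h.mem_parityTuples_iff hαβ
  bijection hαβ := by
    obtain ⟨c, hc⟩ := h.exists_flipPosition_extend hαβ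
    exact ⟨(flipBits_involutive c).toPerm, hc⟩

/-! ### The discrete torus -/

/-- The points of the discrete torus with the coordinate directions `κ`. -/
abbrev Cell (κ : Type*) (N : ℕ) := κ → ZMod N

/-- Every point of the torus carries a left (`false`) and a right (`true`) vertex. -/
abbrev TorusVertex (κ : Type*) (N : ℕ) := Cell κ N × Bool

/-- The edge `(g, l)` joins the left vertex at `g` to the right vertex at `g + shift l`. -/
abbrev TorusEdge (κ : Type*) (N : ℕ) := Cell κ N × Option κ

/-- No edge of `F` starts in the hyperplane `x_j = t`. -/
def FreeAt {κ : Type*} {N : ℕ} (F : Finset (TorusEdge κ N)) (j : κ) (t : ZMod N) : Prop :=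
  ∀ e ∈ F, e.1 j ≠ t

/-- The vertices that lie in a hyperplane in which no edge of `F` starts. -/
def Safe {κ : Type*} {N : ℕ} (F : Finset (TorusEdge κ N)) (v : TorusVertex κ N) : Prop :=
  ∃ j, FreeAt F j (v.1 j)

section FreeAt

variable {κ : Type*} {N : ℕ} {F : Finset (TorusEdge κ N)} {j : κ}

theorem FreeAt.notMem {g : Cell κ N} (h : FreeAt F j (g j)) (l : Option κ) : (g, l) ∉ F :=
  fun hg => h _ hg rfl

theorem exists_notMem_of_card_lt {B : Finset (ZMod N)} (h : B.card < N) : ∃ t, t ∉ B := by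
  have : NeZero N := ⟨by omega⟩
  obtain ⟨t, -, ht⟩ := Finset.exists_mem_notMem_of_card_lt_card
    (h.trans_eq ((ZMod.card N).symm.trans Finset.card_univ.symm))
  exact ⟨t, ht⟩

theorem exists_freeAt (j : κ) (h : F.card < N) : ∃ t, FreeAt F j t := by
  obtain ⟨t, ht⟩ := exists_notMem_of_card_lt
    ((Finset.card_image_le (s := F) (f := fun e => e.1 j)).trans_lt h)
  exact ⟨t, fun e he h => ht (Finset.mem_image.mpr ⟨e, he, h⟩)⟩

theorem exists_freeAt_and_freeAt_sub_one (j : κ) (h : 2 * F.card < N) :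
    ∃ t, FreeAt F j t ∧ FreeAt F j (t - 1) := by
  let B := F.image (fun e => e.1 j) ∪ F.image (fun e => e.1 j + 1)
  have hB : B.card ≤ F.card + F.card :=
    (Finset.card_union_le _ _).trans (add_le_add Finset.card_image_le Finset.card_image_le)
  obtain ⟨t, ht⟩ := exists_notMem_of_card_lt (show B.card < N by omega)
  refine ⟨t, fun e he h => ht ?_, fun e he h => ht ?_⟩
  · exact Finset.mem_union_left _ (Finset.mem_image.mpr ⟨e, he, h⟩)
  · exact Finset.mem_union_right _ (Finset.mem_image.mpr ⟨e, he, eq_sub_iff_add_eq.mp h⟩)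

end FreeAt

section Torus

variable {κ : Type*} [DecidableEq κ] {N : ℕ}

/-- The displacement along the edges with label `l`. -/
def shift (l : Option κ) : Cell κ N := l.elim 0 fun i => Pi.single i 1

/-- The edge with label `l` at a vertex of the torus. -/
def torusInc : TorusVertex κ N → Option κ → TorusEdge κ N
  | (g, false), l => (g, l)
  | (g, true), l => (g - shift l, l)

variable [Fintype κ]

theorem sum_boundary_torusInc [NeZero N] (c : TorusEdge κ N → ZMod 2) :
    ∑ v, boundary torusInc c v = 0 := by
  have hshift (l : Option κ) : ∑ g : Cell κ N, c (g - shift l, l) = ∑ g, c (g, l) :=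
    Equiv.sum_comp (Equiv.subRight (shift l)) fun g => c (g, l)
  simp only [boundary, torusInc, Fintype.sum_prod_type_right, Fintype.sum_bool]
  rw [Finset.sum_comm, Finset.sum_congr rfl fun l _ => hshift l, Finset.sum_comm]
  exact CharTwo.add_self_eq_zero _

theorem boundary_torusInc_single (g : Cell κ N) (l : Option κ) :
    boundary torusInc (Pi.single (g, l) 1) =
      Pi.single (g, false) 1 + Pi.single (g + shift l, true) 1 := by
  ext ⟨g', s⟩
  simp only [boundary, Pi.single_apply, Pi.add_apply]
  cases s
  · by_cases h : g' = g <;> simp [torusInc, h]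
  · rw [Finset.sum_eq_single l (fun l' _ hl' => if_neg fun h => hl' (congrArg Prod.snd h))
      fun h => absurd (Finset.mem_univ l) h]
    simp [torusInc, sub_eq_iff_eq_add]

variable {F : Finset (TorusEdge κ N)} {g z : Cell κ N} {i j : κ}

theorem flow_edge {l : Option κ} (h : (g, l) ∉ F) :
    Flow torusInc F (g, false) (g + shift l, true) :=
  ⟨Pi.single (g, l) 1, fun _ he => Pi.single_eq_of_ne (ne_of_mem_of_not_mem he h) _,
    boundary_torusInc_single g l⟩

theorem flow_sides (h : (g, none) ∉ F) : Flow torusInc F (g, false) (g, true) := by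
  simpa [shift] using flow_edge h

theorem flow_line (n : ℕ) (hsome : ∀ t < n, (g + Pi.single i (t : ZMod N), some i) ∉ F)
    (hnone : ∀ t < n, (g + Pi.single i ((t + 1 : ℕ) : ZMod N), none) ∉ F) :
    Flow torusInc F (g, false) (g + Pi.single i (n : ZMod N), false) := by
  induction n with
  | zero => simpa using Flow.refl
  | succ n ih =>
    have hedge := flow_edge (hsome n n.lt_succ_self)
    rw [shift, Option.elim_some, add_assoc, ← Pi.single_add, ← Nat.cast_succ] at hedge
    exact ((ih (fun t ht => hsome t (ht.trans n.lt_succ_self)) fun t ht =>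
      hnone t (ht.trans n.lt_succ_self)).trans hedge).trans
        (flow_sides (hnone n n.lt_succ_self)).symm

theorem FreeAt.flow_update [NeZero N] (hij : j ≠ i) (h : FreeAt F j (g j)) (t : ZMod N) :
    Flow torusInc F (g, false) (Function.update g i t, false) := by
  have hline (s : ZMod N) (l) : (g + Pi.single i s, l) ∉ F :=
    FreeAt.notMem (j := j) (by simpa [hij] using h) l
  have hupdate : Function.update g i t = g + Pi.single i (((t - g i).val : ℕ) : ZMod N) := by
    ext i'
    obtain rfl | hi' := eq_or_ne i' i <;> simp [*]
  rw [hupdate]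
  exact flow_line _ (fun _ _ => hline _ _) fun _ _ => hline _ _

theorem FreeAt.flow_of_apply_eq [NeZero N] (h : FreeAt F j (g j)) (hgz : g j = z j) :
    Flow torusInc F (g, false) (z, false) := by
  have hS (S : Finset κ) (hjS : j ∉ S) :
      Flow torusInc F (g, false) (S.piecewise z g, false) := by
    induction S using Finset.induction_on with
    | empty => simpa using Flow.refl
    | insert i S _ ih =>
      rw [Finset.mem_insert, not_or] at hjS
      rw [Finset.piecewise_insert]
      refine (ih hjS.2).trans (FreeAt.flow_update hjS.1 ?_ _)
      rwa [Finset.piecewise_eq_of_notMem _ _ _ hjS.2]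
  have hz : (Finset.univ.erase j).piecewise z g = z := by
    ext i
    obtain rfl | hi := eq_or_ne i j <;> simp [*]
  exact hz ▸ hS _ (Finset.notMem_erase j _)

theorem Safe.flow_of_forall_freeAt [NeZero N] [Nontrivial κ] {v : TorusVertex κ N}
    (hv : Safe F v) (hz : ∀ j, FreeAt F j (z j)) : Flow torusInc F v (z, false) := by
  obtain ⟨g, s⟩ := v
  obtain ⟨j, hj⟩ := hv
  obtain ⟨j', hj'⟩ := exists_ne j
  have hs : Flow torusInc F (g, s) (g, false) := by
    cases s
    · exact .refl
    · exact (flow_sides (hj.notMem none)).symm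
  let z' : Cell κ N := Function.update z j (g j)
  have hgz' : Flow torusInc F (g, false) (z', false) :=
    hj.flow_of_apply_eq (Function.update_self j (g j) z).symm
  have hz'z : Flow torusInc F (z', false) (z, false) := by
    have hzj' : z' j' = z j' := Function.update_of_ne hj' _ _
    exact FreeAt.flow_of_apply_eq (j := j') (hzj' ▸ hz j') hzj'
  exact (hs.trans hgz').trans hz'z

end Torus

/-! ### Escape routes -/

section EscapeRoute

variable {κ : Type*} {N : ℕ}

/-- The edges on the escape routes from the left vertex at `z`. The route `none` leads through the
right vertex at `z` to the hyperplane behind `z` in the direction `i₀`; the route `some i` follows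
the line through `z` in the direction `i`, and stops short of that hyperplane. -/
def escapeRoute (i₀ : κ) (z : Cell κ N) : Option κ → Set (TorusEdge κ N)
  | none => {e | e = (z, none) ∨ e.1 i₀ = z i₀ - 1}
  | some i => {e | e.1 i₀ ≠ z i₀ - 1 ∧ (∀ j ≠ i, e.1 j = z j) ∧
      (e.2 = some i ∨ e.2 = none ∧ e.1 i ≠ z i)}

theorem pairwise_disjoint_escapeRoute (i₀ : κ) (z : Cell κ N) :
    Pairwise (Disjoint on escapeRoute i₀ z) := by
  have hnone (i : κ) : Disjoint (escapeRoute i₀ z none) (escapeRoute i₀ z (some i)) := by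
    rw [Set.disjoint_left]
    rintro e (rfl | he) ⟨he', -, hsome | ⟨-, hne⟩⟩
    · cases hsome
    · exact hne rfl
    · exact he' he
    · exact he' he
  rintro (_ | i) (_ | i') hne
  · exact absurd rfl hne
  · exact hnone i'
  · exact (hnone i).symm
  · refine Set.disjoint_left.mpr ?_
    rintro ⟨g, l⟩ ⟨-, -, rfl | ⟨rfl, hi⟩⟩ ⟨-, hline, hi' | ⟨hi', -⟩⟩
    · exact hne hi'
    · cases hi'
    · cases hi'
    · exact hi (hline i fun h => hne (congrArg some h))

variable [DecidableEq κ]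

theorem add_single_apply_ne_sub_one (i₀ i : κ) (z : Cell κ N) {t : ℕ} (ht : t + 1 < N) :
    (z + Pi.single i (t : ZMod N) : Cell κ N) i₀ ≠ z i₀ - 1 := by
  have hcast {s : ℕ} (hs : 0 < s) (hsN : s < N) : (s : ZMod N) ≠ 0 := by
    rw [Ne, ZMod.natCast_eq_zero_iff]
    exact Nat.not_dvd_of_pos_of_lt hs hsN
  rw [Pi.add_apply, sub_eq_add_neg, Ne, add_right_inj, eq_neg_iff_add_eq_zero, Pi.single_apply]
  split_ifs
  · exact_mod_cast hcast t.succ_pos ht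
  · simpa using hcast one_pos (by omega)

theorem some_mem_escapeRoute (i₀ i : κ) (z : Cell κ N) {t : ℕ} (ht : t + 1 < N) :
    (z + Pi.single i (t : ZMod N), some i) ∈ escapeRoute i₀ z (some i) :=
  ⟨add_single_apply_ne_sub_one i₀ i z ht, fun j hj => by simp [hj], .inl rfl⟩

theorem none_mem_escapeRoute (i₀ i : κ) (z : Cell κ N) {t : ℕ} (ht₀ : 0 < t) (ht : t + 1 < N) :
    (z + Pi.single i (t : ZMod N), none) ∈ escapeRoute i₀ z (some i) := by
  refine ⟨add_single_apply_ne_sub_one i₀ i z ht, fun j hj => by simp [hj], .inr ⟨rfl, ?_⟩⟩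
  simpa [ZMod.natCast_eq_zero_iff] using Nat.not_dvd_of_pos_of_lt ht₀ (by omega)

end EscapeRoute

theorem exists_forall_notMem_of_card_lt {α ι : Type*} [Fintype ι] {s : ι → Set α}
    (hs : Pairwise (Disjoint on s)) {G : Finset α} (hG : G.card < Fintype.card ι) :
    ∃ i, ∀ e ∈ G, e ∉ s i := by
  by_contra! h
  choose e heG hes using h
  have hinj : Function.Injective fun i => (⟨e i, heG i⟩ : G) := fun i i' hii' => by
    have hee' : e i = e i' := congrArg Subtype.val hii'
    exact hs.eq (Set.not_disjoint_iff.mpr ⟨e i, hes i, hee' ▸ hes i'⟩)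
  exact hG.not_ge ((Fintype.card_le_of_injective _ hinj).trans_eq (Fintype.card_coe G))

section Evasion

variable {κ : Type*} [DecidableEq κ] [Fintype κ] {N : ℕ} {F : Finset (TorusEdge κ N)}
  {z : Cell κ N} {i : κ}

theorem exists_safe_flow_of_freeAt_sub_one (hz : (z, none) ∉ F) (h : FreeAt F i (z i - 1)) :
    ∃ w, Safe F w ∧ Flow torusInc F (z, false) w := by
  have hi : FreeAt F i ((z - Pi.single i 1 : Cell κ N) i) := by simpa using h
  have hedge := flow_edge (hi.notMem (some i))
  rw [shift, Option.elim_some, sub_add_cancel] at hedge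
  exact ⟨_, ⟨i, hi⟩, (flow_sides hz).trans hedge.symm⟩

theorem exists_safe_flow_of_line (hF : F.card < N)
    (hsome : ∀ t : ℕ, t + 1 < N → (z + Pi.single i (t : ZMod N), some i) ∉ F)
    (hnone : ∀ t : ℕ, 0 < t → t + 1 < N → (z + Pi.single i (t : ZMod N), none) ∉ F) :
    ∃ w, Safe F w ∧ Flow torusInc F (z, false) w := by
  have : NeZero N := ⟨by omega⟩
  obtain ⟨t, ht⟩ := exists_freeAt i hF
  set n := (t - z i).val with hn
  have hnN : n < N := (t - z i).val_lt
  have hfree : FreeAt F i ((z + Pi.single i (n : ZMod N) : Cell κ N) i) := by simpa [hn] using ht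
  refine ⟨_, ⟨i, hfree⟩, flow_line n (fun s hs => hsome s (by omega)) fun s hs => ?_⟩
  obtain hsn | hsn := (Nat.succ_le_of_lt hs).eq_or_lt
  · rw [← hsn] at hfree
    exact hfree.notMem none
  · exact hnone _ s.succ_pos (by omega)

theorem exists_safe_flow [Nontrivial κ] {F' G : Finset (TorusEdge κ N)}
    (hz : ∀ j, FreeAt F j (z j) ∧ FreeAt F j (z j - 1)) (hF' : F' ⊆ F ∪ G)
    (hG : G.card ≤ Fintype.card κ) (hN : F'.card < N) :
    ∃ w, Safe F' w ∧ Flow torusInc F' (z, false) w := by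
  obtain ⟨i₀⟩ : Nonempty κ := inferInstance
  obtain ⟨l, hl⟩ := exists_forall_notMem_of_card_lt (pairwise_disjoint_escapeRoute i₀ z) (G := G)
    (by rw [Fintype.card_option]; omega)
  have hroute {e} (heF : e ∉ F) (he : e ∈ escapeRoute i₀ z l) : e ∉ F' := fun h =>
    (Finset.mem_union.mp (hF' h)).elim heF fun heG => hl e heG he
  obtain _ | i := l
  · refine exists_safe_flow_of_freeAt_sub_one (i := i₀) ?_ fun e he heq => ?_
    · exact hroute ((hz i₀).1.notMem none) (.inl rfl)
    · exact hroute (fun heF => (hz i₀).2 e heF heq) (.inr heq) he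
  · obtain ⟨j, hj⟩ := exists_ne i
    have hline (t : ZMod N) (l) : (z + Pi.single i t, l) ∉ F :=
      FreeAt.notMem (j := j) (by simpa [hj] using (hz j).1) l
    exact exists_safe_flow_of_line hN
      (fun t ht => hroute (hline _ _) (some_mem_escapeRoute i₀ i z ht))
      fun t ht₀ ht => hroute (hline _ _) (none_mem_escapeRoute i₀ i z ht₀ ht)

theorem evasionStrategy_torusInc [Nontrivial κ] {r k : ℕ} (hr : 2 * r ≤ Fintype.card κ)
    (hN : 4 * k < N) : EvasionStrategy (torusInc (κ := κ) (N := N)) r k Safe where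
  exists_notMem := by
    rintro F ⟨g, s⟩ ⟨j, hj⟩
    refine ⟨none, ?_⟩
    cases s
    · exact hj.notMem none
    · simpa [torusInc, shift] using hj.notMem none
  start := by
    intro F hF u
    have : NeZero N := ⟨by omega⟩
    obtain ⟨j⟩ : Nonempty κ := inferInstance
    have hempty (t : ZMod N) (j : κ) : FreeAt ∅ j t := fun e he => absurd he (Finset.notMem_empty e)
    choose z hz using fun j : κ => exists_freeAt (F := F) (N := N) j (by omega)
    exact ⟨(z, false), ⟨j, hz j⟩,
      Safe.flow_of_forall_freeAt ⟨j, hempty _ j⟩ fun j => hempty (z j) j⟩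
  evade := by
    intro F w hF hw
    have : NeZero N := ⟨by omega⟩
    choose z hz using fun j : κ =>
      exists_freeAt_and_freeAt_sub_one (F := F) (N := N) j (by omega)
    refine ⟨(z, false), hw.flow_of_forall_freeAt fun j => (hz j).1, fun hF' hcard hG => ?_⟩
    exact exists_safe_flow hz hF' (hG.trans hr) (by omega)

end Evasion

/-! ### Separation of arities -/

theorem not_logicLE_nuCSPQuantifiers {r ℓ : ℕ} (hℓ : 3 ≤ ℓ) (hr : 0 < r) :
    ¬ LogicLE (nuCSPQuantifiers ℓ (separationArity r ℓ)) (quantifiersOfArity r) := by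
  have : Nontrivial (Fin (2 * r)) := Fin.nontrivial_iff_two_le.mpr (by omega)
  obtain ⟨col, hcol⟩ :=
    exists_coloring_card_fiber_le (ι := Option (Fin (2 * r))) (show 0 < ℓ - 1 by omega)
  have harity : Fintype.card (Coord col) ≤ separationArity r ℓ := by
    simpa [separationArity] using card_coord_le hcol
  refine not_logicLE_of_bijectiveStrategy
    (cspQuantifier_evenTuples_mem_nuCSPQuantifiers hℓ (by rw [Fintype.card_fin]; omega) harity)
    hr fun k => ?_
  let N := 4 * k + 1
  let u : TorusVertex (Fin (2 * r)) N := (0, false)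
  refine ⟨singleStr _ (parityTuples col torusInc 0), ?_,
    singleStr _ (parityTuples col torusInc (Pi.single u 1)), fun hB => ?_, _,
    (evasionStrategy_torusInc (by simp) (Nat.lt_succ_self _)).bijectiveStrategy col u⟩
  · exact singleStr_mem_cspQuantifier_iff.mpr
      (exists_map_mem_evenTuples_iff.mpr ⟨0, by ext; simp [boundary]⟩)
  · obtain ⟨c, hc⟩ := exists_map_mem_evenTuples_iff.mp (singleStr_mem_cspQuantifier_iff.mp hB)
    simpa [hc] using sum_boundary_torusInc c

end PolyQuant

open PolyQuant in
theorem mainTheorem3_general (r ℓ : ℕ) (hℓ : 3 ≤ ℓ) (hr : 0 < r) :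
    ¬ LogicLE (nuCSPQuantifiers ℓ (separationArity r ℓ)) (quantifiersOfArity r) ∧
      ∃ r' : ℕ, r < r' ∧
        LogicLE (nuCSPQuantifiers ℓ r) (nuCSPQuantifiers ℓ r') ∧
        ¬ LogicLE (nuCSPQuantifiers ℓ r') (nuCSPQuantifiers ℓ r) := by
  have hmain := not_logicLE_nuCSPQuantifiers hℓ hr
  have hlt : r < separationArity r ℓ := by
    unfold separationArity
    nlinarith [Nat.zero_le ((2 * r + 1) / (ℓ - 1))]
  refine ⟨hmain, _, hlt, .of_subset ?_, fun h => hmain (h.trans (.of_subset ?_))⟩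
  · exact fun Q hQ => ⟨hQ.1, fun n hn => (hQ.2 n hn).trans hlt.le⟩
  · exact fun Q hQ => hQ.2

theorem mainTheorem3 (r ℓ : ℕ) (hℓ : 3 ≤ ℓ) (hr : ℓ ≤ r) :
    ¬ PolyQuant.LogicLE (PolyQuant.nuCSPQuantifiers ℓ (PolyQuant.separationArity r ℓ))
        (PolyQuant.quantifiersOfArity r) ∧
      ∃ r' : ℕ, r < r' ∧
        PolyQuant.LogicLE (PolyQuant.nuCSPQuantifiers ℓ r) (PolyQuant.nuCSPQuantifiers ℓ r') ∧
        ¬ PolyQuant.LogicLE (PolyQuant.nuCSPQuantifiers ℓ r')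
          (PolyQuant.nuCSPQuantifiers ℓ r) :=
  mainTheorem3_general r ℓ hℓ (by omega)
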